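/- Let $F$ be an algebraically closed field of characteristic $0$, let $G$ be a finite (additive) abelian group, and let $\beta : G\times G\to F^\times$ be an alternating bicharacter, i.e. $\beta$ is multiplicative in each argument and $\beta(g,g)=1$ for all $g$. Put $\operatorname{Rad}(\beta)=\{g\in G : \beta(g,h)=1 \text{ for all } h\in G\}$ and assume that $(G,\beta)$ is nonsingular, i.e. $\operatorname{Rad}(\beta)=0$. Definitions (for an abelian group with an alternating bicharacter, again denoted $(G,\beta)$). A subset $R\subseteq G$ is a *skew root system of Lie type* in $(G,\beta)$ if $\operatorname{Rad}(\beta)\ne G$, $R\subseteq G\setminus\operatorname{Rad}(\beta)$, $R$ generates $G$, $-a\in R$ for all $a\in R$, and $a+b\in R$ whenever $a,b\in R$ and $\beta(a,b)\ne 1$. It is a *skew root system of Jordan type* if $R$ generates $G$, $-a\in R$ for all $a\in R$, and $a+b\in R$ whenever $a,b\in R$ and $\beta(a,b)\neq -1$. A skew root system in $(G,\beta)$ is *reduced* if $(G,\beta)$ is nonsingular. A skew root system $R$ of Lie type is *decomposable* if $G=G_1\oplus G_2$ for proper subgroups $G_1,G_2$ with $\beta(G_1,G_2)=1$, and $R=R_1\cup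 R_2$ with $\beta(R_1,R_2)=1$ and $R_i\subseteq G_i$ a skew root system of Lie type in $(G_i,\beta|_{G_i})$ for $i=1,2$; otherwise it is *indecomposable*. A $2$-cocycle $\xi:G\times G\to F^\times$ (for the trivial action) *corresponds* to $\beta$ if $\beta(a,b)=\xi(a,b)\xi(b,a)^{-1}$ for all $a,b$. The *twisted group algebra* $F^\xi G$ is the associative algebra with basis $(u_a)_{a\in G}$ and product $u_au_b=\xi(a,b)u_{a+b}$. For $\xi$ corresponding to $\beta$, $L(R)=\bigoplus_{a\in R}Fu_a$ with bracket $[x,y]=xy-yx$ if $R$ is of Lie type, and $J(R)=\bigoplus_{a\in R}Fu_a$ with product $x\circ y=\frac12(xy+yx)$ if $R$ is of Jordan type. $M_n(F)^+$ denotes $M_n(F)$ with the product $x\circ y=\frac12(xy+yx)$. Then a $2$-cocycle corresponding to $\beta$ exists, there is an $n$ with $|G|=n^2$, and: 1. If $G\neq 0$, then $R^-=G\setminus\{0\}$ is a reduced and indecomposable skew root system of Lie type in $(G,\beta)$, and $L(R^-)\cong \mathfrak{sl}_n(F)$ as Lie algebras, for every $2$-cocycle $\xi$ corresponding to $\beta$.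 2. $R^+=G$ is a reduced skew root system of Jordan type in $(G,\beta)$, and $J(R^+)\cong M_n(F)^+$ as Jordan algebras over $F$, for every $2$-cocycle $\xi$ corresponding to $\beta$. -/

import Mathlib

attribute [local instance] LieRing.ofAssociativeRing

/-- An alternating bicharacter `β : G × G → Fˣ` on an additive abelian group `G`. -/
structure AltBichar (G F : Type*) [AddCommGroup G] [Field F] where
  toFun : G → G → Fˣ
  map_add_left : ∀ a b c, toFun (a + b) c = toFun a c * toFun b c
  map_add_right : ∀ a b c, toFun a (b + c) = toFun a b * toFun a c
  map_self : ∀ a, toFun a a = 1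

/-- A 2-cocycle on `G` with values in `Fˣ` (trivial action). -/
structure MulTwoCocycle (G F : Type*) [AddCommGroup G] [Field F] where
  toFun : G → G → Fˣ
  cocycle : ∀ a b c, toFun a b * toFun (a + b) c = toFun b c * toFun a (b + c)

namespace AltBichar

variable {G F : Type*} [AddCommGroup G] [Field F]

instance : CoeFun (AltBichar G F) (fun _ => G → G → Fˣ) := ⟨AltBichar.toFun⟩

theorem map_zero_left (β : AltBichar G F) (c : G) : β 0 c = 1 := by
  have h := β.map_add_left 0 0 c
  rw [add_zero] at h
  exact (mul_eq_left.mp h.symm)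

theorem map_neg_left (β : AltBichar G F) (a c : G) : β (-a) c = (β a c)⁻¹ := by
  have h := β.map_add_left (-a) a c
  rw [neg_add_cancel, β.map_zero_left] at h
  exact eq_inv_of_mul_eq_one_left h.symm

/-- The radical of `β`. -/
def radical (β : AltBichar G F) : AddSubgroup G where
  carrier := {g | ∀ h, β g h = 1}
  zero_mem' := fun h => β.map_zero_left h
  add_mem' := fun {a b} ha hb h => by rw [β.map_add_left, ha h, hb h, one_mul]
  neg_mem' := fun {a} ha h => by rw [β.map_neg_left, ha h, inv_one]

/-- `(G, β)` is nonsingular if the radical of `β` is zero. -/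
def IsNonsingular (β : AltBichar G F) : Prop := β.radical = ⊥

/-- The restriction of `β` to a subgroup. -/
def restrict (β : AltBichar G F) (H : AddSubgroup G) : AltBichar H F where
  toFun := fun a b => β (a : G) (b : G)
  map_add_left := fun a b c => β.map_add_left a b c
  map_add_right := fun a b c => β.map_add_right a b c
  map_self := fun a => β.map_self a

end AltBichar

/-- A skew root system of Lie type in `(G, β)`. -/
structure LieSkewRootSystem {G F : Type*} [AddCommGroup G] [Field F] (β : AltBichar G F) where
  carrier : Set G
  nontrivial : β.radical ≠ ⊤
  subset : ∀ a ∈ carrier, a ∉ β.radical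
  generates : AddSubgroup.closure carrier = ⊤
  neg_mem : ∀ a ∈ carrier, -a ∈ carrier
  add_mem : ∀ a ∈ carrier, ∀ b ∈ carrier, β a b ≠ 1 → a + b ∈ carrier

/-- A skew root system of Jordan type in `(G, β)`. -/
structure JordanSkewRootSystem {G F : Type*} [AddCommGroup G] [Field F] (β : AltBichar G F) where
  carrier : Set G
  generates : AddSubgroup.closure carrier = ⊤
  neg_mem : ∀ a ∈ carrier, -a ∈ carrier
  add_mem : ∀ a ∈ carrier, ∀ b ∈ carrier, β a b ≠ -1 → a + b ∈ carrier

/-- A skew root system of Lie type in `(G, β)` is reduced if `β` is nonsingular. -/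
def LieSkewRootSystem.IsReduced {G F : Type*} [AddCommGroup G] [Field F] {β : AltBichar G F}
    (_R : LieSkewRootSystem β) : Prop := β.IsNonsingular

/-- A skew root system of Jordan type in `(G, β)` is reduced if `β` is nonsingular. -/
def JordanSkewRootSystem.IsReduced {G F : Type*} [AddCommGroup G] [Field F] {β : AltBichar G F}
    (_R : JordanSkewRootSystem β) : Prop := β.IsNonsingular

/-- `R` is decomposable if `G` is the orthogonal direct sum of two proper subgroups `G₁`, `G₂`, and
`R` is the union of two orthogonal subsets which are skew root systems of Lie type in `G₁` and
`G₂` respectively. -/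
def LieSkewRootSystem.IsDecomposable {G F : Type*} [AddCommGroup G] [Field F] {β : AltBichar G F}
    (R : LieSkewRootSystem β) : Prop :=
  ∃ G₁ G₂ : AddSubgroup G, G₁ ≠ ⊤ ∧ G₂ ≠ ⊤ ∧ IsCompl G₁ G₂ ∧
    (∀ a ∈ G₁, ∀ b ∈ G₂, β a b = 1) ∧
    ∃ (R₁ : LieSkewRootSystem (β.restrict G₁)) (R₂ : LieSkewRootSystem (β.restrict G₂)),
      R.carrier = (fun a : G₁ => (a : G)) '' R₁.carrier ∪ (fun a : G₂ => (a : G)) '' R₂.carrier ∧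
      ∀ a ∈ R₁.carrier, ∀ b ∈ R₂.carrier, β (a : G) (b : G) = 1

/-- `R` is indecomposable if it is not decomposable. -/
def LieSkewRootSystem.IsIndecomposable {G F : Type*} [AddCommGroup G] [Field F]
    {β : AltBichar G F} (R : LieSkewRootSystem β) : Prop := ¬ R.IsDecomposable

/-- The cocycle `ξ` corresponds to `β` if `β (a, b) = ξ (a, b) ξ (b, a)⁻¹` for all `a`, `b`. -/
def MulTwoCocycle.Corresponds {G F : Type*} [AddCommGroup G] [Field F]
    (ξ : MulTwoCocycle G F) (β : AltBichar G F) : Prop :=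
  ∀ a b, β a b = ξ.toFun a b * (ξ.toFun b a)⁻¹

/-- The underlying vector space of the twisted group algebra: the `F`-vector space with basis
`u a`, `a ∈ G`. -/
def TwistedGroupAlgebra {G F : Type*} [AddCommGroup G] [Field F] (_ξ : MulTwoCocycle G F) :
    Type _ := G →₀ F

namespace TwistedGroupAlgebra

variable {G F : Type*} [AddCommGroup G] [Field F] (ξ : MulTwoCocycle G F)

noncomputable instance : AddCommGroup (TwistedGroupAlgebra ξ) :=
  inferInstanceAs (AddCommGroup (G →₀ F))

noncomputable instance : Module F (TwistedGroupAlgebra ξ) :=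
  inferInstanceAs (Module F (G →₀ F))

/-- The basis `u`. -/
noncomputable def basis : Module.Basis G F (TwistedGroupAlgebra ξ) := Module.Basis.ofRepr
  (LinearEquiv.refl F (G →₀ F))

/-- The basis element `u a`. -/
noncomputable def u (a : G) : TwistedGroupAlgebra ξ := basis ξ a

/-- The multiplication: the bilinear map with `u a * u b = ξ (a, b) u (a + b)`. -/
noncomputable def mulMap :
    TwistedGroupAlgebra ξ →ₗ[F] TwistedGroupAlgebra ξ →ₗ[F] TwistedGroupAlgebra ξ :=
  (basis ξ).constr F fun a => (basis ξ).constr F fun b => (ξ.toFun a b : F) • u ξ (a + b)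

theorem mulMap_u_u (a b : G) : mulMap ξ (u ξ a) (u ξ b) = (ξ.toFun a b : F) • u ξ (a + b) := by
  simp [mulMap, u, Module.Basis.constr_basis]

theorem induction {p : TwistedGroupAlgebra ξ → Prop} (x : TwistedGroupAlgebra ξ)
    (hu : ∀ a, p (u ξ a)) (h0 : p 0) (ha : ∀ x y, p x → p y → p (x + y))
    (hs : ∀ (c : F) x, p x → p (c • x)) : p x := by
  have hx : x ∈ Submodule.span F (Set.range (basis ξ)) := by
    rw [(basis ξ).span_eq]; trivial
  induction hx using Submodule.span_induction with
  | mem x h => obtain ⟨a, rfl⟩ := h; exact hu a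
  | zero => exact h0
  | add x y _ _ hx hy => exact ha x y hx hy
  | smul c x _ hx => exact hs c x hx

theorem mulMap_assoc (x y z : TwistedGroupAlgebra ξ) :
    mulMap ξ (mulMap ξ x y) z = mulMap ξ x (mulMap ξ y z) := by
  induction x using induction with
  | h0 => simp
  | ha x x' h h' => simp [h, h']
  | hs c x h => simp [h]
  | hu a =>
    induction y using induction with
    | h0 => simp
    | ha x x' h h' => simp [h, h']
    | hs c x h => simp [h]
    | hu b =>
      induction z using induction with
      | h0 => simp
      | ha x x' h h' => simp [h, h']
      | hs c x h => simp [h]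
      | hu c =>
        simp only [mulMap_u_u, map_smul, LinearMap.smul_apply, smul_smul, add_assoc]
        congr 1
        exact_mod_cast ξ.cocycle a b c

theorem cocycle_zero_left (a : G) : ξ.toFun 0 a = ξ.toFun 0 0 := by
  have h := ξ.cocycle 0 0 a
  simp only [zero_add] at h
  exact (mul_right_cancel h).symm

theorem cocycle_zero_right (a : G) : ξ.toFun a 0 = ξ.toFun 0 0 := by
  have h := ξ.cocycle a 0 0
  simp only [add_zero] at h
  exact mul_right_cancel h

/-- The identity element `ξ (0, 0)⁻¹ u 0`. -/
noncomputable def one : TwistedGroupAlgebra ξ := ((ξ.toFun 0 0)⁻¹ : Fˣ).val • u ξ 0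

theorem mulMap_one_left (x : TwistedGroupAlgebra ξ) : mulMap ξ (one ξ) x = x := by
  induction x using induction with
  | h0 => simp
  | ha x x' h h' => simp [h, h']
  | hs c x h => simp [h]
  | hu a =>
    simp only [one, map_smul, LinearMap.smul_apply, mulMap_u_u, smul_smul, cocycle_zero_left,
      zero_add, Units.inv_mul, one_smul]

theorem mulMap_one_right (x : TwistedGroupAlgebra ξ) : mulMap ξ x (one ξ) = x := by
  induction x using induction with
  | h0 => simp
  | ha x x' h h' => simp [h, h']
  | hs c x h => simp [h]
  | hu a =>
    simp only [one, map_smul, mulMap_u_u, smul_smul, cocycle_zero_right,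
      add_zero, Units.inv_mul, one_smul]

noncomputable instance : Ring (TwistedGroupAlgebra ξ) :=
  { (inferInstance : AddCommGroup (TwistedGroupAlgebra ξ)) with
    mul := fun x y => mulMap ξ x y
    one := one ξ
    left_distrib := fun x y z => (mulMap ξ x).map_add y z
    right_distrib := fun x y z => (mulMap ξ).map_add₂ x y z
    zero_mul := fun x => (mulMap ξ).map_zero₂ x
    mul_zero := fun x => (mulMap ξ x).map_zero
    mul_assoc := mulMap_assoc ξ
    one_mul := mulMap_one_left ξ
    mul_one := mulMap_one_right ξ }

theorem mul_def (x y : TwistedGroupAlgebra ξ) : x * y = mulMap ξ x y := rfl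

noncomputable instance : Algebra F (TwistedGroupAlgebra ξ) :=
  Algebra.ofModule (fun c x y => (mulMap ξ).map_smul₂ c x y) (fun c x y => (mulMap ξ x).map_smul c y)

theorem u_mul_u (a b : G) : u ξ a * u ξ b = (ξ.toFun a b : F) • u ξ (a + b) := mulMap_u_u ξ a b

/-- The subspace `⨁ a ∈ R, F u a`. -/
noncomputable def spanOf (R : Set G) : Submodule F (TwistedGroupAlgebra ξ) :=
  Submodule.span F (u ξ '' R)

theorem lie_mem_spanOf {β : AltBichar G F} (R : LieSkewRootSystem β) (hξ : ξ.Corresponds β)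
    {x y : TwistedGroupAlgebra ξ} (hx : x ∈ spanOf ξ R.carrier) (hy : y ∈ spanOf ξ R.carrier) :
    ⁅x, y⁆ ∈ spanOf ξ R.carrier := by
  induction hx using Submodule.span_induction with
  | zero => simp
  | add x x' _ _ h h' => rw [add_lie]; exact add_mem h h'
  | smul c x _ h => rw [smul_lie]; exact Submodule.smul_mem _ c h
  | mem x hx =>
    obtain ⟨a, ha, rfl⟩ := hx
    induction hy using Submodule.span_induction with
    | zero => simp
    | add x x' _ _ h h' => rw [lie_add]; exact add_mem h h'
    | smul c x _ h => rw [lie_smul]; exact Submodule.smul_mem _ c h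
    | mem y hy =>
      obtain ⟨b, hb, rfl⟩ := hy
      rw [Ring.lie_def, u_mul_u, u_mul_u, add_comm b a, ← sub_smul]
      by_cases h : β a b = 1
      · rw [hξ a b, mul_inv_eq_one] at h
        rw [h, sub_self, zero_smul]
        exact Submodule.zero_mem _
      · exact Submodule.smul_mem _ _
          (Submodule.subset_span ⟨_, R.add_mem a ha b hb h, rfl⟩)

/-- The Lie algebra `L(R)`, a Lie subalgebra of the twisted group algebra with the commutator
bracket. -/
noncomputable def L {β : AltBichar G F} (R : LieSkewRootSystem β) (hξ : ξ.Corresponds β) :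
    LieSubalgebra F (TwistedGroupAlgebra ξ) :=
  { spanOf ξ R.carrier with lie_mem' := fun hx hy => lie_mem_spanOf ξ R hξ hx hy }

end TwistedGroupAlgebra

/-- In an algebra over a field of characteristic zero, `2` is invertible. -/
@[reducible] noncomputable def invertibleTwoOfAlgebra (F A : Type*) [Field F] [CharZero F] [Ring A]
    [Algebra F A] : Invertible (2 : A) where
  invOf := algebraMap F A (2⁻¹)
  invOf_mul_self := by
    rw [← map_ofNat (algebraMap F A) 2, ← map_mul, inv_mul_cancel₀ two_ne_zero, map_one]
  mul_invOf_self := by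
    rw [← map_ofNat (algebraMap F A) 2, ← map_mul, mul_inv_cancel₀ two_ne_zero, map_one]

noncomputable instance {G F : Type*} [AddCommGroup G] [Field F] [CharZero F]
    (ξ : MulTwoCocycle G F) : Invertible (2 : TwistedGroupAlgebra ξ) :=
  invertibleTwoOfAlgebra F _

noncomputable instance {F : Type*} [Field F] [CharZero F] (n : ℕ) :
    Invertible (2 : Matrix (Fin n) (Fin n) F) :=
  invertibleTwoOfAlgebra F _

namespace TwistedGroupAlgebra

variable {G F : Type*} [AddCommGroup G] [Field F] [CharZero F] (ξ : MulTwoCocycle G F)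

theorem jordan_mem_spanOf {β : AltBichar G F} (R : JordanSkewRootSystem β)
    (hξ : ξ.Corresponds β) {x y : TwistedGroupAlgebra ξ} (hx : x ∈ spanOf ξ R.carrier)
    (hy : y ∈ spanOf ξ R.carrier) : ⅟2 * (x * y + y * x) ∈ spanOf ξ R.carrier := by
  have key : x * y + y * x ∈ spanOf ξ R.carrier := by
    induction hx using Submodule.span_induction with
    | zero => simp
    | add x x' _ _ h h' =>
      rw [add_mul, mul_add, add_add_add_comm]; exact add_mem h h'
    | smul c x _ h =>
      rw [smul_mul_assoc, mul_smul_comm, ← smul_add]; exact Submodule.smul_mem _ c h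
    | mem x hx =>
      obtain ⟨a, ha, rfl⟩ := hx
      induction hy using Submodule.span_induction with
      | zero => simp
      | add x x' _ _ h h' =>
        rw [add_mul, mul_add, add_add_add_comm]; exact add_mem h h'
      | smul c x _ h =>
        rw [smul_mul_assoc, mul_smul_comm, ← smul_add]; exact Submodule.smul_mem _ c h
      | mem y hy =>
        obtain ⟨b, hb, rfl⟩ := hy
        rw [u_mul_u, u_mul_u, add_comm b a, ← add_smul]
        by_cases h : β a b = -1
        · rw [hξ a b, mul_inv_eq_iff_eq_mul] at h
          rw [h]
          simp
        · exact Submodule.smul_mem _ _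
            (Submodule.subset_span ⟨_, R.add_mem a ha b hb h, rfl⟩)
  have h2 : (⅟2 : TwistedGroupAlgebra ξ) = algebraMap F _ (2⁻¹) := rfl
  rw [h2, ← Algebra.smul_def]
  exact Submodule.smul_mem _ _ key

/-- The Jordan algebra `J(R)`, a subalgebra of the twisted group algebra with the Jordan product
`x ∘ y = (x y + y x) / 2`. -/
noncomputable def J {β : AltBichar G F} (R : JordanSkewRootSystem β) (hξ : ξ.Corresponds β) :
    NonUnitalSubalgebra F (TwistedGroupAlgebra ξ)ˢʸᵐ where
  carrier := {x | SymAlg.unsym x ∈ spanOf ξ R.carrier}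
  zero_mem' := (spanOf ξ R.carrier).zero_mem
  add_mem' := fun hx hy => (spanOf ξ R.carrier).add_mem hx hy
  smul_mem' := fun c _ hx => (spanOf ξ R.carrier).smul_mem c hx
  mul_mem' := fun hx hy => jordan_mem_spanOf ξ R hξ hx hy

end TwistedGroupAlgebra

/-! A nonsingular `β` makes the twisted group algebra a full matrix algebra. Conjugation by `u b`
scales `u d` by `β b d`, so averaging conjugates against the character `β a` projects onto the line
of `u a` (`sum_conj_eq`, by orthogonality of characters). Hence a nonzero two-sided ideal contains
some `u a`, which is a unit, and the algebra is simple. Over an algebraically closed field it is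
`M_n(F)`, and comparing dimensions gives `|G| = n ^ 2`.

Conjugation preserves the trace but scales `u a`, `a ≠ 0`, by a scalar that is not always 1; so
these basis elements have trace zero, and their span is exactly `sl_n`. The span of all `u a` is
`M_n(F)` itself, which gives the Jordan case.

A cocycle exists because a splitting of `G` into cyclic groups presents `β` as a matrix of
bicharacters with trivial diagonal, whose strictly upper half is a cocycle. -/

namespace AltBichar

/-! ### Alternating bicharacters and existence of a cocycle -/

variable {G F : Type*} [AddCommGroup G] [Field F]

theorem mul_swap (β : AltBichar G F) (a b : G) : β a b * β b a = 1 := by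
  have h := β.map_self (a + b)
  rwa [β.map_add_left, β.map_add_right, β.map_add_right, β.map_self, β.map_self, one_mul,
    mul_one] at h

theorem map_zero_right (β : AltBichar G F) (a : G) : β a 0 = 1 := by
  have h := β.mul_swap a 0
  rwa [β.map_zero_left, mul_one] at h

theorem map_neg_right (β : AltBichar G F) (a c : G) : β a (-c) = (β a c)⁻¹ := by
  have h := β.map_add_right a (-c) c
  rw [neg_add_cancel, β.map_zero_right] at h
  exact eq_inv_of_mul_eq_one_left h.symm

/-- The homomorphism `β (-, c)`. -/
def leftHom (β : AltBichar G F) (c : G) : G →+ Additive Fˣ where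
  toFun a := Additive.ofMul (β a c)
  map_zero' := congrArg Additive.ofMul (β.map_zero_left c)
  map_add' a b := congrArg Additive.ofMul (β.map_add_left a b c)

/-- The homomorphism `β (a, -)`. -/
def rightHom (β : AltBichar G F) (a : G) : G →+ Additive Fˣ where
  toFun c := Additive.ofMul (β a c)
  map_zero' := congrArg Additive.ofMul (β.map_zero_right a)
  map_add' b c := congrArg Additive.ofMul (β.map_add_right a b c)

theorem map_sum_left (β : AltBichar G F) {ι : Type*} (s : Finset ι) (f : ι → G) (c : G) :
    β (∑ i ∈ s, f i) c = ∏ i ∈ s, β (f i) c :=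
  congrArg Additive.toMul (map_sum (β.leftHom c) f s)

theorem map_sum_right (β : AltBichar G F) {ι : Type*} (s : Finset ι) (f : ι → G) (a : G) :
    β a (∑ i ∈ s, f i) = ∏ i ∈ s, β a (f i) :=
  congrArg Additive.toMul (map_sum (β.rightHom a) f s)

theorem map_zsmul_left (β : AltBichar G F) (m : ℤ) (a c : G) : β (m • a) c = β a c ^ m :=
  congrArg Additive.toMul (map_zsmul (β.leftHom c) m a)

theorem map_zsmul_right (β : AltBichar G F) (m : ℤ) (a c : G) : β a (m • c) = β a c ^ m :=
  congrArg Additive.toMul (map_zsmul (β.rightHom a) m c)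

theorem eq_one_of_isAddCyclic (β : AltBichar G F) {C : Type*} [AddCommGroup C] [IsAddCyclic C]
    (f : C →+ G) (x y : C) : β (f x) (f y) = 1 := by
  obtain ⟨g, hg⟩ := IsAddCyclic.exists_generator (α := C)
  obtain ⟨m, rfl⟩ := AddSubgroup.mem_zmultiples_iff.mp (hg x)
  obtain ⟨k, rfl⟩ := AddSubgroup.mem_zmultiples_iff.mp (hg y)
  rw [map_zsmul, map_zsmul, β.map_zsmul_left, β.map_zsmul_right, β.map_self, one_zpow, one_zpow]

/-- A decomposition of the identity into homomorphisms with `β`-isotropic images yields a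
2-cocycle corresponding to `β`. -/
theorem exists_corresponds_of_sum_eq (β : AltBichar G F) {ι : Type*} [Fintype ι] [LinearOrder ι]
    (π : ι → G →+ G) (hπ : ∀ a, ∑ i, π i a = a) (hβ : ∀ i a b, β (π i a) (π i b) = 1) :
    ∃ ξ : MulTwoCocycle G F, ξ.Corresponds β := by
  let f : G → G → Fˣ := fun a b => ∏ i, ∏ j, if i < j then β (π i a) (π j b) else 1
  have f_left (a b c) : f (a + b) c = f a c * f b c := by
    simp only [f, ← Finset.prod_mul_distrib]
    refine Finset.prod_congr rfl fun i _ => Finset.prod_congr rfl fun j _ => ?_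
    split_ifs
    · rw [map_add, β.map_add_left]
    · rw [one_mul]
  have f_right (a b c) : f a (b + c) = f a b * f a c := by
    simp only [f, ← Finset.prod_mul_distrib]
    refine Finset.prod_congr rfl fun i _ => Finset.prod_congr rfl fun j _ => ?_
    split_ifs
    · rw [map_add, β.map_add_right]
    · rw [one_mul]
  refine ⟨⟨f, fun a b c => by rw [f_left, f_right, mul_comm (f b c), mul_assoc]⟩, fun a b => ?_⟩
  change β a b = f a b * (f b a)⁻¹
  have hba : (f b a)⁻¹ = ∏ i, ∏ j, if j < i then β (π i a) (π j b) else 1 := by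
    simp only [f]
    rw [Finset.prod_comm]
    simp only [← Finset.prod_inv_distrib]
    refine Finset.prod_congr rfl fun i _ => Finset.prod_congr rfl fun j _ => ?_
    split_ifs
    · exact inv_eq_of_mul_eq_one_left (β.mul_swap _ _)
    · exact inv_one
  rw [hba]
  simp only [f, ← Finset.prod_mul_distrib]
  conv_lhs => rw [← hπ a, ← hπ b]
  rw [β.map_sum_left]
  refine Finset.prod_congr rfl fun i _ => ?_
  rw [β.map_sum_right]
  refine Finset.prod_congr rfl fun j _ => ?_
  rcases lt_trichotomy i j with h | rfl | h
  · rw [if_pos h, if_neg h.asymm, mul_one]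
  · rw [if_neg (lt_irrefl i), mul_one, hβ]
  · rw [if_pos h, if_neg h.asymm, one_mul]

theorem exists_corresponds [Finite G] (β : AltBichar G F) :
    ∃ ξ : MulTwoCocycle G F, ξ.Corresponds β := by
  classical
  obtain ⟨ι, _, n, -, ⟨e⟩⟩ := AddCommGroup.equiv_directSum_zmod_of_finite' G
  -- The order of the cyclic factors is arbitrary; it only selects a triangular half.
  let _ : LinearOrder ι := LinearOrder.lift' (Fintype.equivFin ι) (Fintype.equivFin ι).injective
  refine β.exists_corresponds_of_sum_eq
    (fun i => (e.symm.toAddMonoidHom.comp (DirectSum.of (fun i => ZMod (n i)) i)).comp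
      ((DFinsupp.evalAddMonoidHom i).comp e.toAddMonoidHom)) (fun a => ?_) (fun i a b => ?_)
  · apply e.injective
    rw [map_sum]
    simp only [AddMonoidHom.coe_comp, Function.comp_apply, AddEquiv.coe_toAddMonoidHom,
      AddEquiv.apply_symm_apply]
    exact DirectSum.sum_univ_of (e a)
  · exact β.eq_one_of_isAddCyclic
      (e.symm.toAddMonoidHom.comp (DirectSum.of (fun i => ZMod (n i)) i)) (e a i) (e b i)

theorem IsNonsingular.exists_ne_one {β : AltBichar G F} (hβ : β.IsNonsingular) {a : G}
    (ha : a ≠ 0) : ∃ b, β a b ≠ 1 := by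
  by_contra! h
  have : a ∈ β.radical := h
  rw [hβ] at this
  exact ha this

/-- Translating the summation variable by `c` multiplies the sum by `β a c`, and some `c` has `β a c
≠ 1`. -/
theorem IsNonsingular.sum_eq_zero [Fintype G] {β : AltBichar G F} (hβ : β.IsNonsingular) {a : G}
    (ha : a ≠ 0) : ∑ b, (β a b : F) = 0 := by
  obtain ⟨c, hc⟩ := hβ.exists_ne_one ha
  have h : (β a c : F) * ∑ b, (β a b : F) = ∑ b, (β a b : F) := by
    rw [Finset.mul_sum]
    refine Fintype.sum_equiv (Equiv.addLeft c) _ _ fun b => ?_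
    rw [Equiv.coe_addLeft, β.map_add_right, Units.val_mul]
  have h' : ((β a c : F) - 1) * ∑ b, (β a b : F) = 0 := by rw [sub_mul, h, one_mul, sub_self]
  exact (mul_eq_zero.mp h').resolve_left (sub_ne_zero.mpr fun h => hc (Units.ext h))

end AltBichar

/-! ### The twisted group algebra as a matrix algebra -/

namespace TwistedGroupAlgebra

section Ring

variable {G F : Type*} [AddCommGroup G] [Field F] (ξ : MulTwoCocycle G F)

theorem one_eq : (1 : TwistedGroupAlgebra ξ) = ((ξ.toFun 0 0)⁻¹ : Fˣ).val • u ξ 0 := rfl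

theorem u_zero : u ξ 0 = (ξ.toFun 0 0 : F) • (1 : TwistedGroupAlgebra ξ) := by
  rw [one_eq, smul_smul, Units.mul_inv, one_smul]

/-- The inverse of `u a`. -/
noncomputable def uInv (a : G) : TwistedGroupAlgebra ξ :=
  ((ξ.toFun a (-a) * ξ.toFun 0 0)⁻¹ : Fˣ).val • u ξ (-a)

theorem u_mul_uInv (a : G) : u ξ a * uInv ξ a = 1 := by
  rw [uInv, mul_smul_comm, u_mul_u, add_neg_cancel, u_zero, smul_smul, smul_smul, mul_assoc,
    ← Units.val_mul, Units.inv_mul, one_smul]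

theorem uInv_mul_u (a : G) : uInv ξ a * u ξ a = 1 := by
  have h : ξ.toFun (-a) a = ξ.toFun a (-a) := by
    have h := ξ.cocycle a (-a) a
    rw [add_neg_cancel, neg_add_cancel, cocycle_zero_left, cocycle_zero_right _ a] at h
    exact (mul_right_cancel h).symm
  rw [uInv, smul_mul_assoc, u_mul_u, neg_add_cancel, u_zero, smul_smul, smul_smul, mul_assoc, h,
    ← Units.val_mul, ← Units.val_mul, inv_mul_cancel, Units.val_one, one_smul]

instance : Nontrivial (TwistedGroupAlgebra ξ) :=
  inferInstanceAs (Nontrivial (G →₀ F))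

instance [Finite G] : Module.Finite F (TwistedGroupAlgebra ξ) :=
  Module.Finite.of_basis (basis ξ)

variable {ξ} {β : AltBichar G F}

theorem u_mul_comm (hξ : ξ.Corresponds β) (a b : G) :
    u ξ a * u ξ b = (β a b : F) • (u ξ b * u ξ a) := by
  rw [u_mul_u, u_mul_u, smul_smul, ← Units.val_mul, hξ a b, inv_mul_cancel_right, add_comm b a]

theorem u_mul_u_mul_uInv (hξ : ξ.Corresponds β) (a b : G) :
    u ξ b * u ξ a * uInv ξ b = (β b a : F) • u ξ a := by
  rw [u_mul_comm hξ, smul_mul_assoc, mul_assoc, u_mul_uInv, mul_one]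

/-- On `u d` the weighted conjugates are `β (a - d) b • u d`; summing over `b` leaves only `d = a`,
with multiplicity `|G|`. -/
theorem sum_conj_eq [Fintype G] (hξ : ξ.Corresponds β) (hβ : β.IsNonsingular) (a : G)
    (x : TwistedGroupAlgebra ξ) :
    ∑ b, (β a b : F) • (u ξ b * x * uInv ξ b) =
      ((Fintype.card G : F) * (basis ξ).repr x a) • u ξ a := by
  classical
  induction x using TwistedGroupAlgebra.induction with
  | h0 => simp
  | ha x y hx hy =>
    simp only [mul_add, add_mul, smul_add, Finset.sum_add_distrib, hx, hy, map_add,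
      Finsupp.add_apply, add_smul]
  | hs c x hx =>
    simp only [mul_smul_comm, smul_mul_assoc, smul_comm _ c]
    rw [← Finset.smul_sum, hx, map_smul, Finsupp.smul_apply, smul_eq_mul, smul_smul,
      mul_left_comm]
  | hu d =>
    have h (b : G) : (β a b : F) • (u ξ b * u ξ d * uInv ξ b) = (β (a - d) b : F) • u ξ d := by
      rw [u_mul_u_mul_uInv hξ, smul_smul, ← Units.val_mul, sub_eq_add_neg, β.map_add_left,
        β.map_neg_left, inv_eq_of_mul_eq_one_right (β.mul_swap d b)]
    simp only [h, ← Finset.sum_smul]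
    have hrepr : (basis ξ).repr (u ξ d) a = if d = a then 1 else 0 := by
      rw [u, Module.Basis.repr_self, Finsupp.single_apply]
    rw [hrepr]
    split_ifs with hd
    · subst hd
      simp [β.map_zero_left]
    · rw [hβ.sum_eq_zero (sub_ne_zero.mpr (Ne.symm hd)), zero_smul, mul_zero, zero_smul]

/-- The projection of `sum_conj_eq` maps an ideal into itself, and `|G|` is invertible in
characteristic 0, so a nonzero ideal contains some unit `u a`. -/
theorem isSimpleRing [Finite G] [CharZero F] (hξ : ξ.Corresponds β) (hβ : β.IsNonsingular) :
    IsSimpleRing (TwistedGroupAlgebra ξ) := by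
  refine .of_eq_bot_or_eq_top fun I => or_iff_not_imp_left.mpr fun hI => ?_
  have := Fintype.ofFinite G
  obtain ⟨x, hxI, hx⟩ := SetLike.exists_of_lt (bot_lt_iff_ne_bot.mpr hI)
  have hx0 : (basis ξ).repr x ≠ 0 := fun h => hx ((LinearEquiv.map_eq_zero_iff _).mp h)
  obtain ⟨a, ha⟩ := Finsupp.ne_iff.mp hx0
  have hsmul (c : F) {y : TwistedGroupAlgebra ξ} (hy : y ∈ I) : c • y ∈ I := by
    rw [Algebra.smul_def]
    exact I.mul_mem_left _ _ hy
  have hmem : ((Fintype.card G : F) * (basis ξ).repr x a) • u ξ a ∈ I := by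
    rw [← sum_conj_eq hξ hβ a x]
    exact sum_mem fun b _ => hsmul _ (I.mul_mem_right _ _ (I.mul_mem_left _ _ hxI))
  have hu : u ξ a ∈ I := by
    have hc : (Fintype.card G : F) * (basis ξ).repr x a ≠ 0 :=
      mul_ne_zero (Nat.cast_ne_zero.mpr Fintype.card_ne_zero) ha
    rw [← inv_smul_smul₀ hc (u ξ a)]
    exact hsmul _ hmem
  rw [← I.one_mem_iff, ← u_mul_uInv ξ a]
  exact I.mul_mem_right _ _ hu

theorem exists_algEquiv_matrix [Finite G] [CharZero F] [IsAlgClosed F] (hξ : ξ.Corresponds β)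
    (hβ : β.IsNonsingular) {n : ℕ} (hn : Nat.card G = n ^ 2) :
    Nonempty (TwistedGroupAlgebra ξ ≃ₐ[F] Matrix (Fin n) (Fin n) F) := by
  have := isSimpleRing hξ hβ
  obtain ⟨m, -, ⟨e⟩⟩ := IsSimpleRing.exists_algEquiv_matrix_of_isAlgClosed F
    (TwistedGroupAlgebra ξ)
  have h := e.toLinearEquiv.finrank_eq
  rw [Module.finrank_eq_nat_card_basis (basis ξ), hn, Module.finrank_matrix] at h
  have hmn : n = m := by
    apply Nat.pow_left_injective two_ne_zero
    simpa [sq] using h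
  exact hmn ▸ ⟨e⟩

theorem exists_card_eq_sq [Finite G] [CharZero F] [IsAlgClosed F] (hξ : ξ.Corresponds β)
    (hβ : β.IsNonsingular) : ∃ n : ℕ, Nat.card G = n ^ 2 := by
  have := isSimpleRing hξ hβ
  obtain ⟨m, -, ⟨e⟩⟩ := IsSimpleRing.exists_algEquiv_matrix_of_isAlgClosed F
    (TwistedGroupAlgebra ξ)
  have h := e.toLinearEquiv.finrank_eq
  rw [Module.finrank_eq_nat_card_basis (basis ξ), Module.finrank_matrix] at h
  exact ⟨m, by simpa [sq] using h⟩

/-- Conjugating by `u b` with `β a b ≠ 1` rescales `u a` but preserves its trace. -/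
theorem trace_u {n : ℕ} (hξ : ξ.Corresponds β) (hβ : β.IsNonsingular)
    (e : TwistedGroupAlgebra ξ ≃ₐ[F] Matrix (Fin n) (Fin n) F) {a : G} (ha : a ≠ 0) :
    (e (u ξ a)).trace = 0 := by
  obtain ⟨b, hb⟩ := hβ.exists_ne_one ha
  have h : (e (u ξ a * u ξ b * uInv ξ b)).trace = (β a b : F) * (e (u ξ a)).trace := by
    rw [u_mul_comm hξ, smul_mul_assoc, map_smul, Matrix.trace_smul, smul_eq_mul, mul_assoc, map_mul,
      Matrix.trace_mul_comm, ← map_mul, mul_assoc, uInv_mul_u, mul_one]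
  rw [mul_assoc, u_mul_uInv, mul_one] at h
  have h' : ((β a b : F) - 1) * (e (u ξ a)).trace = 0 := by rw [sub_mul, ← h, one_mul, sub_self]
  exact (mul_eq_zero.mp h').resolve_left (sub_ne_zero.mpr fun h => hb (Units.ext h))

theorem trace_u_zero {n : ℕ} (e : TwistedGroupAlgebra ξ ≃ₐ[F] Matrix (Fin n) (Fin n) F) :
    (e (u ξ 0)).trace = ξ.toFun 0 0 * n := by
  rw [u_zero, map_smul, map_one, Matrix.trace_smul, Matrix.trace_one, Fintype.card_fin,
    smul_eq_mul]

theorem trace_eq_zero_of_mem_spanOf {n : ℕ} (hξ : ξ.Corresponds β) (hβ : β.IsNonsingular)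
    (e : TwistedGroupAlgebra ξ ≃ₐ[F] Matrix (Fin n) (Fin n) F) {x : TwistedGroupAlgebra ξ}
    (hx : x ∈ spanOf ξ {0}ᶜ) : (e x).trace = 0 := by
  induction hx using Submodule.span_induction with
  | zero => simp
  | add x y _ _ hx hy => rw [map_add, Matrix.trace_add, hx, hy, add_zero]
  | smul c x _ hx => rw [map_smul, Matrix.trace_smul, hx, smul_zero]
  | mem x hx =>
    obtain ⟨a, ha, rfl⟩ := hx
    exact trace_u hξ hβ e ha

/-- For the converse, split off the `u 0` component: its trace is a nonzero multiple of its
coefficient, so the coefficient vanishes. -/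
theorem mem_spanOf_compl_zero {n : ℕ} [NeZero n] [CharZero F] (hξ : ξ.Corresponds β)
    (hβ : β.IsNonsingular) (e : TwistedGroupAlgebra ξ ≃ₐ[F] Matrix (Fin n) (Fin n) F)
    (x : TwistedGroupAlgebra ξ) : x ∈ spanOf ξ {0}ᶜ ↔ (e x).trace = 0 := by
  refine ⟨trace_eq_zero_of_mem_spanOf hξ hβ e, fun h => ?_⟩
  have hx : x ∈ Submodule.span F (insert (u ξ 0) (u ξ '' {0}ᶜ)) := by
    rw [← Set.image_insert_eq, ← Set.union_singleton, Set.compl_union_self, Set.image_univ]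
    exact (basis ξ).mem_span x
  obtain ⟨c, y, hy, rfl⟩ := Submodule.mem_span_insert.mp hx
  rw [map_add, Matrix.trace_add, trace_eq_zero_of_mem_spanOf hξ hβ e hy, add_zero, map_smul,
    Matrix.trace_smul, trace_u_zero, smul_eq_mul] at h
  have hc : c = 0 := (mul_eq_zero.mp h).resolve_right
    (mul_ne_zero (Units.ne_zero _) (Nat.cast_ne_zero.mpr (NeZero.ne n)))
  rwa [hc, zero_smul, zero_add]

end Ring

/-! ### Identification of the Lie and Jordan algebras -/

section Algebras

variable {G F : Type*} [AddCommGroup G] [Field F] [CharZero F] {ξ : MulTwoCocycle G F}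
  {β : AltBichar G F}

theorem nonempty_lieEquiv_sl {n : ℕ} [NeZero n] (R : LieSkewRootSystem β)
    (hR : R.carrier = {0}ᶜ) (hξ : ξ.Corresponds β) (hβ : β.IsNonsingular)
    (e : TwistedGroupAlgebra ξ ≃ₐ[F] Matrix (Fin n) (Fin n) F) :
    Nonempty (L ξ R hξ ≃ₗ⁅F⁆ LieAlgebra.SpecialLinear.sl (Fin n) F) := by
  have hmem (x : TwistedGroupAlgebra ξ) : x ∈ L ξ R hξ ↔ (e x).trace = 0 := by
    rw [← mem_spanOf_compl_zero hξ hβ e, ← hR]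
    rfl
  refine ⟨e.toLieEquiv.ofSubalgebras _ _ (LieSubalgebra.ext _ _ fun y => ?_)⟩
  constructor
  · rintro ⟨x, hx, rfl⟩
    exact (hmem x).mp hx
  · intro hy
    refine ⟨e.symm y, (hmem _).mpr ?_, e.apply_symm_apply y⟩
    rw [e.apply_symm_apply]
    exact hy

theorem exists_linearEquiv_symAlg {n : ℕ} (R : JordanSkewRootSystem β)
    (hR : R.carrier = Set.univ) (hξ : ξ.Corresponds β)
    (e : TwistedGroupAlgebra ξ ≃ₐ[F] Matrix (Fin n) (Fin n) F) :
    ∃ f : J ξ R hξ ≃ₗ[F] (Matrix (Fin n) (Fin n) F)ˢʸᵐ, ∀ x y, f (x * y) = f x * f y := by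
  have hmem (x : (TwistedGroupAlgebra ξ)ˢʸᵐ) : x ∈ J ξ R hξ := by
    change SymAlg.unsym x ∈ Submodule.span F (u ξ '' R.carrier)
    rw [hR, Set.image_univ]
    exact (basis ξ).mem_span _
  let f : J ξ R hξ ≃ₗ[F] (Matrix (Fin n) (Fin n) F)ˢʸᵐ :=
    { toFun := fun x => SymAlg.sym (e (SymAlg.unsym x.1))
      invFun := fun y => ⟨SymAlg.sym (e.symm (SymAlg.unsym y)), hmem _⟩
      left_inv := fun x => Subtype.ext (congrArg SymAlg.sym (e.symm_apply_apply _))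
      right_inv := fun y => congrArg SymAlg.sym (e.apply_symm_apply _)
      map_add' := fun x y => by simp
      map_smul' := fun c x => by simp }
  refine ⟨f, fun x y => ?_⟩
  change SymAlg.sym (e (SymAlg.unsym (x.1 * y.1))) =
    SymAlg.sym (e (SymAlg.unsym x.1)) * SymAlg.sym (e (SymAlg.unsym y.1))
  rw [SymAlg.sym_mul_sym, SymAlg.unsym_mul]
  -- Both halves are by definition images of the scalar `2⁻¹`, so `e` carries one to the other.
  have h₁ : (⅟2 : TwistedGroupAlgebra ξ) = algebraMap F _ 2⁻¹ := rfl
  have h₂ : (⅟2 : Matrix (Fin n) (Fin n) F) = algebraMap F _ 2⁻¹ := rfl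
  rw [h₁, h₂, map_mul e, map_add e, map_mul e, map_mul e, AlgEquiv.commutes]

end Algebras

end TwistedGroupAlgebra

/-! ### The two root systems -/

section RootSystems

variable {G F : Type*} [AddCommGroup G] [Field F] {β : AltBichar G F}

/-- The skew root system `G \ {0}` of Lie type. -/
def LieSkewRootSystem.complZero [Nontrivial G] (hβ : β.IsNonsingular) : LieSkewRootSystem β where
  carrier := {0}ᶜ
  nontrivial := by
    rw [hβ]
    exact bot_ne_top
  subset a ha h := by
    rw [hβ] at h
    exact ha h
  generates := by
    refine (AddSubgroup.eq_top_iff' _).mpr fun a => ?_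
    by_cases ha : a = 0
    · rw [ha]
      exact zero_mem _
    · exact AddSubgroup.subset_closure ha
  neg_mem _ ha := neg_ne_zero.mpr ha
  -- If `a + b = 0` then `b = -a`, which forces `β a b = 1`.
  add_mem a _ b _ h h' := h <| by
    rw [Set.mem_singleton_iff, add_eq_zero_iff_eq_neg'] at h'
    rw [h', β.map_neg_right, β.map_self, inv_one]

/-- A sum of nonzero elements, one from each summand, is a nonzero element of `G` lying in neither
summand. -/
theorem LieSkewRootSystem.isIndecomposable_of_carrier_eq (R : LieSkewRootSystem β)
    (hR : R.carrier = {0}ᶜ) : R.IsIndecomposable := by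
  rintro ⟨G₁, G₂, h₁, h₂, hc, -, R₁, R₂, hR', -⟩
  have hne₁ : G₁ ≠ ⊥ := fun h => h₂ (eq_top_of_bot_isCompl (h ▸ hc))
  have hne₂ : G₂ ≠ ⊥ := fun h => h₁ (eq_top_of_isCompl_bot (h ▸ hc))
  obtain ⟨a, ha, ha0⟩ := (AddSubgroup.bot_or_exists_ne_zero G₁).resolve_left hne₁
  obtain ⟨b, hb, hb0⟩ := (AddSubgroup.bot_or_exists_ne_zero G₂).resolve_left hne₂
  have hdisj {x : G} (hx₁ : x ∈ G₁) (hx₂ : x ∈ G₂) : x = 0 :=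
    AddSubgroup.disjoint_def.mp hc.disjoint hx₁ hx₂
  have hab : a + b ∈ R.carrier := by
    rw [hR]
    intro h
    rw [Set.mem_singleton_iff, add_eq_zero_iff_eq_neg] at h
    exact ha0 (hdisj ha (h ▸ G₂.neg_mem hb))
  rw [hR'] at hab
  rcases hab with ⟨c, -, hc⟩ | ⟨c, -, hc⟩
  · have : a + b ∈ G₁ := hc ▸ c.2
    exact hb0 (hdisj ((add_mem_cancel_left ha).mp this) hb)
  · have : a + b ∈ G₂ := hc ▸ c.2
    exact ha0 (hdisj ha ((add_mem_cancel_right hb).mp this))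

/-- The skew root system `G` of Jordan type. -/
def JordanSkewRootSystem.univ (β : AltBichar G F) : JordanSkewRootSystem β where
  carrier := Set.univ
  generates := AddSubgroup.closure_univ
  neg_mem _ _ := Set.mem_univ _
  add_mem _ _ _ _ _ := Set.mem_univ _

end RootSystems

theorem mainTheorem5 {F : Type*} [Field F] [IsAlgClosed F] [CharZero F]
    {G : Type*} [AddCommGroup G] [Finite G] (β : AltBichar G F) (hβ : β.IsNonsingular) :
    (∃ ξ : MulTwoCocycle G F, ξ.Corresponds β) ∧
    ∃ n : ℕ, Nat.card G = n ^ 2 ∧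
      (Nontrivial G → ∃ R : LieSkewRootSystem β, R.carrier = {0}ᶜ ∧
        R.IsReduced ∧ R.IsIndecomposable ∧
        ∀ (ξ : MulTwoCocycle G F) (hξ : ξ.Corresponds β),
          Nonempty (TwistedGroupAlgebra.L ξ R hξ ≃ₗ⁅F⁆ LieAlgebra.SpecialLinear.sl (Fin n) F)) ∧
      (∃ R : JordanSkewRootSystem β, R.carrier = Set.univ ∧
        R.IsReduced ∧
        ∀ (ξ : MulTwoCocycle G F) (hξ : ξ.Corresponds β),
          ∃ e : TwistedGroupAlgebra.J ξ R hξ ≃ₗ[F] (Matrix (Fin n) (Fin n) F)ˢʸᵐ,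
            ∀ x y, e (x * y) = e x * e y) := by
  obtain ⟨ξ₀, hξ₀⟩ := β.exists_corresponds
  obtain ⟨n, hn⟩ := TwistedGroupAlgebra.exists_card_eq_sq hξ₀ hβ
  have : NeZero n := ⟨by
    rintro rfl
    exact Nat.card_pos.ne' hn⟩
  refine ⟨⟨ξ₀, hξ₀⟩, n, hn, fun _ => ?_, JordanSkewRootSystem.univ β, rfl, hβ, fun ξ hξ => ?_⟩
  · refine ⟨.complZero hβ, rfl, hβ, LieSkewRootSystem.isIndecomposable_of_carrier_eq _ rfl,
      fun ξ hξ => ?_⟩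
    obtain ⟨e⟩ := TwistedGroupAlgebra.exists_algEquiv_matrix hξ hβ hn
    exact TwistedGroupAlgebra.nonempty_lieEquiv_sl _ rfl hξ hβ e
  · obtain ⟨e⟩ := TwistedGroupAlgebra.exists_algEquiv_matrix hξ hβ hn
    exact TwistedGroupAlgebra.exists_linearEquiv_symAlg _ rfl hξ e
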